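/- Let $(H,\rho)$ be a complete $\mathrm{CAT}(0)$ space with the geodesic extension property: every unit-speed geodesic $[0,L]\to H$ with $L>0$ extends to an isometry $\mathbb{R}\to H$. For $p,x\in H$ let $\gamma_{p,x}:[0,1]\to H$ be the constant-speed geodesic from $p$ to $x$, and for a geodesic $\gamma$ let $\zeta(\gamma)=0$ if $\gamma$ is constant and $\zeta(\gamma)=1$ otherwise. For $p\in H$ let $S_p$ be the metric space obtained from the set of constant-speed geodesics $[0,1]\to H$ issuing from $p$ (constant ones included), with the Alexandrov angle $\angle_p$ as pseudometric, by identifying geodesics at angle $0$; the angle is the limit as $s,t\to0^+$ of the Euclidean comparison angle at $p$ between $\gamma_1(s)$ and $\gamma_2(t)$, where by convention the comparison angle is $0$ if both points equal $p$ and $\pi/2$ if exactly one does. The tangent space $T_pH$ is the quotient of $[0,\infty)\times S_p$ in which $(t_1,\gamma_1)\sim(t_2,\gamma_2)$ if and only if $t_1\zeta(\gamma_1)=t_2\zeta(\gamma_2)=0$, or $t_1\zeta(\gamma_1)=t_2\zeta(\gamma_2)>0$ and $\gamma_1=\gamma_2$ in $S_p$. The class of $(t,\gamma)$ is written $t\gamma$,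 and $0_p:=0\gamma$. Put $$d_p(t_1\gamma_1,t_2\gamma_2)=\sqrt{t_1^2\zeta(\gamma_1)+t_2^2\zeta(\gamma_2)-2t_1t_2\zeta(\gamma_1)\zeta(\gamma_2)\cos\angle_p(\gamma_1,\gamma_2)},$$ $\|v\|_p=d_p(0_p,v)$ and $g_p(v,w)=\tfrac12\left[\|v\|_p^2+\|w\|_p^2-d_p(v,w)^2\right]$. Let $A$ be a set-valued vector field on $H$, that is, $Ap\subset T_pH$ for every $p\in H$ (possibly $Ap=\emptyset$). Suppose that $A$ is monotone, i.e. $g_p(\eta,\gamma_{p,q})\le -g_q(\nu,\gamma_{q,p})$ for all $p,q\in H$, $\eta\in Ap$, $\nu\in Aq$, and that it satisfies the surjectivity condition: for all $t>0$ and $x\in H$ there is $p\in H$ with $t\rho(p,x)\gamma_{p,x}\in Ap$. Suppose moreover that $A^{-1}(\mathbf 0):=\{p\in H: 0_p\in Ap\}$ is nonempty. For $x\in H$ let $J_\lambda x:=\{z\in H:\lambda^{-1}\rho(z,x)\gamma_{z,x}\in Az\}$ for $\lambda>0$, let $J_0x:=\{x\}$, and let $P_{A^{-1}(\mathbf 0)}x:=\operatorname{argmin}_{y\in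 A^{-1}(\mathbf 0)}\rho(x,y)$. Then $J_\lambda x$ and $P_{A^{-1}(\mathbf 0)}x$ consist of exactly one point for all $\lambda\ge 0$ and $x\in H$, and, identifying these sets with their points, $$\lim_{\lambda\to\infty}J_\lambda x=P_{A^{-1}(\mathbf 0)}x\quad\text{in the metric }\rho,\text{ for every }x\in H.$$ -/

import Mathlib

open Set Filter Topology
open scoped NNReal unitInterval

noncomputable section

namespace CAT0

section Geodesics

variable (X : Type*) [MetricSpace X]

/-- A normalized geodesic: a constant-speed geodesic `c : [0,1] → X`
(the zero speed is allowed). -/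
structure NormalizedGeodesic where
  toFun : I → X
  dist_eq' : ∃ K : ℝ, 0 ≤ K ∧ ∀ s t : I, dist (toFun s) (toFun t) = K * |(s : ℝ) - t|

instance : CoeFun (NormalizedGeodesic X) (fun _ => I → X) := ⟨NormalizedGeodesic.toFun⟩

/-- The Euclidean plane. -/
abbrev Plane := EuclideanSpace ℝ (Fin 2)

/-- `CAT(0)` spaces: geodesic metric spaces in which, for all geodesic triangles, the distance of
two points on the sides is at most the distance of the comparison points in a Euclidean comparison
triangle. Two sides of a triangle always share a vertex `p`; the two points are `c s` on the side
`c` from `p` to `q` and `c' t` on the side `c'` from `p` to `r`. (Two points on one and the same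
side have the same distance as their comparison points.) -/
class CAT0Space : Prop where
  exists_geodesic : ∀ x y : X, ∃ c : NormalizedGeodesic X, c 0 = x ∧ c 1 = y
  comparison : ∀ (p q r : X) (c c' : NormalizedGeodesic X),
    c 0 = p → c 1 = q → c' 0 = p → c' 1 = r →
    ∀ p' q' r' : Plane, dist p' q' = dist p q → dist q' r' = dist q r → dist r' p' = dist r p →
    ∀ s t : I, dist (c s) (c' t) ≤
      dist (AffineMap.lineMap p' q' (s : ℝ)) (AffineMap.lineMap p' r' (t : ℝ))

/-- The geodesic extension property: every unit-speed geodesic `[0,L] → X` (on a nondegenerate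
interval) is the restriction of an isometry `ℝ → X`. -/
def GeodesicExtensionProperty : Prop :=
  ∀ (L : ℝ) (γ : ℝ → X), 0 < L →
    (∀ s ∈ Icc 0 L, ∀ t ∈ Icc 0 L, dist (γ s) (γ t) = |s - t|) →
    ∃ η : ℝ → X, Isometry η ∧ ∀ t ∈ Icc 0 L, η t = γ t

end Geodesics

section Angles

variable {X : Type*} [MetricSpace X]

/-- The angle at `p'` in a Euclidean comparison triangle of `p, q, r`, given by the law of cosines,
with the conventions for the degenerate cases. -/
def comparisonAngle (p q r : X) : ℝ :=
  open Classical in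
  if q = p ∧ r = p then 0
  else if q = p ∨ r = p then Real.pi / 2
  else Real.arccos ((dist p q ^ 2 + dist p r ^ 2 - dist q r ^ 2) / (2 * dist p q * dist p r))

/-- The normalized geodesics issuing from `p`. -/
structure GeodesicFrom (p : X) extends NormalizedGeodesic X where
  source' : toFun 0 = p

instance (p : X) : CoeFun (GeodesicFrom p) (fun _ => I → X) := ⟨fun c => c.toFun⟩

/-- The Alexandrov angle between two geodesics issuing from `p`. -/
def alexandrovAngle {p : X} (c c' : GeodesicFrom p) : ℝ :=
  limUnder (𝓝[>] (0 : I) ×ˢ 𝓝[>] (0 : I)) (fun st : I × I => comparisonAngle p (c st.1) (c' st.2))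

/-! ### The Alexandrov angle is a pseudometric -/

theorem comparisonAngle_comm (p q r : X) : comparisonAngle p q r = comparisonAngle p r q := by
  unfold comparisonAngle
  have h : (dist p q ^ 2 + dist p r ^ 2 - dist q r ^ 2) / (2 * dist p q * dist p r) =
      (dist p r ^ 2 + dist p q ^ 2 - dist r q ^ 2) / (2 * dist p r * dist p q) := by
    rw [dist_comm q r]; congr 1 <;> ring
  rw [h]
  by_cases h1 : q = p <;> by_cases h2 : r = p <;> simp [h1, h2]

theorem comparisonAngle_nonneg (p q r : X) : 0 ≤ comparisonAngle p q r := by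
  unfold comparisonAngle
  split_ifs
  · exact le_rfl
  · positivity
  · exact Real.arccos_nonneg _

theorem comparisonAngle_le_pi (p q r : X) : comparisonAngle p q r ≤ Real.pi := by
  unfold comparisonAngle
  have := Real.pi_pos
  split_ifs
  · exact this.le
  · linarith
  · exact Real.arccos_le_pi _

theorem comparisonAngle_of_ne {p q r : X} (hq : q ≠ p) (hr : r ≠ p) :
    comparisonAngle p q r =
      Real.arccos ((dist p q ^ 2 + dist p r ^ 2 - dist q r ^ 2) / (2 * dist p q * dist p r)) := by
  simp [comparisonAngle, hq, hr]

theorem comparison_ratio_mem {p q r : X} (hq : q ≠ p) (hr : r ≠ p) :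
    -1 ≤ (dist p q ^ 2 + dist p r ^ 2 - dist q r ^ 2) / (2 * dist p q * dist p r) ∧
    (dist p q ^ 2 + dist p r ^ 2 - dist q r ^ 2) / (2 * dist p q * dist p r) ≤ 1 := by
  have h1 : 0 < dist p q := dist_pos.2 hq.symm
  have h2 : 0 < dist p r := dist_pos.2 hr.symm
  have h3 : 0 < 2 * dist p q * dist p r := by positivity
  have t1 := dist_triangle q p r
  have t2 := dist_triangle p q r
  have t3 := dist_triangle p r q
  rw [dist_comm q p] at t1
  rw [dist_comm r q] at t3
  have h4 : 0 ≤ dist q r := dist_nonneg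
  constructor
  · rw [le_div_iff₀ h3]; nlinarith
  · rw [div_le_iff₀ h3]; nlinarith [
      sq_le_sq' (a := dist p q - dist p r) (b := dist q r) (by linarith) (by linarith)]

theorem law_cos {p q r : X} (hq : q ≠ p) (hr : r ≠ p) :
    dist q r ^ 2 = dist p q ^ 2 + dist p r ^ 2
      - 2 * dist p q * dist p r * Real.cos (comparisonAngle p q r) := by
  have h1 : 0 < dist p q := dist_pos.2 hq.symm
  have h2 : 0 < dist p r := dist_pos.2 hr.symm
  have h := comparison_ratio_mem hq hr
  rw [comparisonAngle_of_ne hq hr, Real.cos_arccos h.1 h.2]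
  field_simp
  ring

namespace GeodesicFrom

variable {p : X}

theorem source (c : GeodesicFrom p) : c 0 = p := c.source'

/-- The length (equivalently the speed) of a normalized geodesic. -/
def len (c : GeodesicFrom p) : ℝ := dist p (c 1)

theorem dist_eq (c : GeodesicFrom p) (s t : I) : dist (c s) (c t) = c.len * |(s : ℝ) - t| := by
  obtain ⟨K, hK, h⟩ := c.dist_eq'
  have h1 := h 0 1
  rw [show c.toFun 0 = p from c.source] at h1
  have : c.len = K := by rw [len, h1]; simp
  rw [this]; exact h s t

theorem len_nonneg (c : GeodesicFrom p) : 0 ≤ c.len := dist_nonneg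

theorem dist_source (c : GeodesicFrom p) (s : I) : dist p (c s) = c.len * s := by
  have h := c.dist_eq 0 s
  rw [c.source] at h
  rw [h]
  simp [abs_of_nonneg s.2.1]

theorem eq_source_iff (c : GeodesicFrom p) {s : I} (hs : 0 < s) : c s = p ↔ c.len = 0 := by
  have hs' : (s : ℝ) ≠ 0 := fun h => hs.ne' (Subtype.ext h)
  rw [eq_comm, ← dist_eq_zero, c.dist_source]
  simp [hs']

/-- The restriction of `c` to `[0,s]`, reparametrized over `[0,1]`. -/
def restrict (c : GeodesicFrom p) (s : I) : GeodesicFrom p where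
  toFun u := c (s * u)
  dist_eq' := ⟨c.len * s, mul_nonneg c.len_nonneg s.2.1, fun u v => by
    rw [c.dist_eq]
    simp only [Icc.coe_mul, ← mul_sub, abs_mul, abs_of_nonneg s.2.1]
    ring⟩
  source' := by simpa using c.source

end GeodesicFrom

theorem GeodesicFrom.exists_point {p : X} (c : GeodesicFrom p) (h : 0 < c.len) {s0 : I} {r : ℝ}
    (hr : 0 < r) (hr' : r ≤ s0 * c.len) : ∃ s : I, 0 < s ∧ s ≤ s0 ∧ dist p (c s) = r := by
  have h1 : r / c.len ≤ s0 := (div_le_iff₀ h).2 hr'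
  refine ⟨⟨r / c.len, by positivity, h1.trans s0.2.2⟩, ?_, h1, ?_⟩
  · change (0 : ℝ) < r / c.len
    positivity
  · rw [c.dist_source]
    field_simp

theorem exists_plane_triangle (p q r : X) : ∃ p' q' r' : Plane,
    dist p' q' = dist p q ∧ dist q' r' = dist q r ∧ dist r' p' = dist r p := by
  by_cases hq : q = p
  · subst hq
    refine ⟨0, 0, !₂[dist q r, 0], ?_⟩
    simp [EuclideanSpace.norm_eq, dist_comm r q]
  by_cases hr : r = p
  · subst hr
    refine ⟨0, !₂[dist r q, 0], 0, ?_⟩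
    simp [EuclideanSpace.norm_eq, dist_comm q r]
  set θ := comparisonAngle p q r
  have hs := Real.sin_sq_add_cos_sq θ
  refine ⟨0, !₂[dist p q, 0], !₂[dist p r * Real.cos θ, dist p r * Real.sin θ], ?_, ?_, ?_⟩
  · simp [EuclideanSpace.norm_eq]
  · rw [EuclideanSpace.dist_eq, ← Real.sqrt_sq (dist_nonneg (x := q) (y := r)), law_cos hq hr]
    congr 1
    simp [Real.dist_eq, sq_abs]
    linear_combination (dist p r ^ 2) * hs
  · rw [EuclideanSpace.dist_eq, dist_comm r p, ← Real.sqrt_sq (dist_nonneg (x := p) (y := r))]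
    congr 1
    simp [sq_abs]
    linear_combination (dist p r ^ 2) * hs

theorem plane_dist_sq (p' q' r' : Plane) (s t : ℝ) :
    dist (AffineMap.lineMap p' q' s) (AffineMap.lineMap p' r' t) ^ 2 =
      s ^ 2 * dist p' q' ^ 2 + t ^ 2 * dist r' p' ^ 2
        - s * t * (dist p' q' ^ 2 + dist r' p' ^ 2 - dist q' r' ^ 2) := by
  have e1 : dist (AffineMap.lineMap p' q' s) (AffineMap.lineMap p' r' t)
      = ‖s • (q' - p') - t • (r' - p')‖ := by
    rw [dist_eq_norm]; congr 1
    simp [AffineMap.lineMap_apply]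
  have e2 : dist q' r' = ‖(q' - p') - (r' - p')‖ := by rw [dist_eq_norm]; congr 1; abel
  have e3 : dist p' q' = ‖q' - p'‖ := by rw [dist_comm, dist_eq_norm]
  rw [e1, e2, e3, dist_eq_norm]
  generalize q' - p' = x
  generalize r' - p' = y
  rw [norm_sub_sq_real, norm_sub_sq_real, norm_smul, norm_smul,
    inner_smul_left, inner_smul_right, mul_pow, mul_pow, Real.norm_eq_abs, Real.norm_eq_abs,
    sq_abs, sq_abs]
  simp
  ring

variable [CAT0Space X] {p : X}

theorem comparisonAngle_restrict_le (c c' : GeodesicFrom p) {s t : I} (hs : 0 < s) (ht : 0 < t) :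
    comparisonAngle p (c s) (c' t) ≤ comparisonAngle p (c 1) (c' 1) := by
  have h01 : (0 : I) < 1 := zero_lt_one
  by_cases hc : c.len = 0
  · simp [comparisonAngle, c.eq_source_iff hs, c.eq_source_iff h01, c'.eq_source_iff ht,
      c'.eq_source_iff h01, hc]
  by_cases hc' : c'.len = 0
  · simp [comparisonAngle, c.eq_source_iff hs, c.eq_source_iff h01, c'.eq_source_iff ht,
      c'.eq_source_iff h01, hc']
  have n1 : c s ≠ p := fun h => hc ((c.eq_source_iff hs).1 h)
  have n2 : c' t ≠ p := fun h => hc' ((c'.eq_source_iff ht).1 h)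
  have n3 : c 1 ≠ p := fun h => hc ((c.eq_source_iff h01).1 h)
  have n4 : c' 1 ≠ p := fun h => hc' ((c'.eq_source_iff h01).1 h)
  rw [comparisonAngle_of_ne n1 n2, comparisonAngle_of_ne n3 n4]
  apply Real.arccos_le_arccos
  obtain ⟨p', q', r', h1, h2, h3⟩ := exists_plane_triangle p (c 1) (c' 1)
  have hcmp := CAT0Space.comparison p (c 1) (c' 1) c.toNormalizedGeodesic c'.toNormalizedGeodesic
    c.source rfl c'.source rfl p' q' r' h1 h2 h3 s t
  have hsq := pow_le_pow_left₀ dist_nonneg hcmp 2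
  rw [plane_dist_sq, h1, h2, h3, dist_comm (c' 1) p] at hsq
  have hK : 0 < c.len := lt_of_le_of_ne c.len_nonneg (Ne.symm hc)
  have hK' : 0 < c'.len := lt_of_le_of_ne c'.len_nonneg (Ne.symm hc')
  have hs' : (0 : ℝ) < s := hs
  have ht' : (0 : ℝ) < t := ht
  change _ ≤ (s : ℝ) ^ 2 * c.len ^ 2 + (t : ℝ) ^ 2 * c'.len ^ 2
    - s * t * (c.len ^ 2 + c'.len ^ 2 - dist (c 1) (c' 1) ^ 2) at hsq
  change (c.len ^ 2 + c'.len ^ 2 - dist (c 1) (c' 1) ^ 2) / (2 * c.len * c'.len) ≤ _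
  rw [c.dist_source, c'.dist_source, div_le_div_iff₀ (by positivity) (by positivity)]
  have hpos : 0 < 2 * c.len * c'.len := by positivity
  have := mul_le_mul_of_nonneg_left hsq hpos.le
  linarith

theorem comparisonAngle_mono (c c' : GeodesicFrom p) {s t s' t' : I} (hs : 0 < s) (ht : 0 < t)
    (hss : s ≤ s') (htt : t ≤ t') :
    comparisonAngle p (c s) (c' t) ≤ comparisonAngle p (c s') (c' t') := by
  have hs' : 0 < s' := hs.trans_le hss
  have ht' : 0 < t' := ht.trans_le htt
  have key : ∀ {a b : I}, 0 < a → a ≤ b → ∃ u : I, 0 < u ∧ b * u = a := by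
    intro a b ha hab
    have ha' : (0 : ℝ) < a := ha
    have hab' : (a : ℝ) ≤ b := hab
    have hb' : (0 : ℝ) < b := ha'.trans_le hab'
    refine ⟨⟨(a : ℝ) / b, by positivity, (div_le_one hb').2 hab'⟩, ?_, ?_⟩
    · change (0 : ℝ) < a / b
      positivity
    · apply Subtype.ext
      simp only [Icc.coe_mul]
      field_simp
  obtain ⟨u, hu, rfl⟩ := key hs hss
  obtain ⟨v, hv, rfl⟩ := key ht htt
  simpa [GeodesicFrom.restrict] using
    comparisonAngle_restrict_le (c.restrict s') (c'.restrict t') hu hv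

instance nhdsGT_zero_neBot : (𝓝[>] (0 : I)).NeBot :=
  nhdsGT_neBot_of_exists_gt ⟨1, zero_lt_one⟩

theorem tendsto_comparisonAngle (c c' : GeodesicFrom p) :
    Tendsto (fun st : I × I => comparisonAngle p (c st.1) (c' st.2))
      (𝓝[>] (0 : I) ×ˢ 𝓝[>] (0 : I)) (𝓝 (alexandrovAngle c c')) := by
  apply tendsto_nhds_limUnder
  set f : I × I → ℝ := fun st => comparisonAngle p (c st.1) (c' st.2)
  set S : Set ℝ := f '' {st | 0 < st.1 ∧ 0 < st.2}
  have hbdd : BddBelow S := ⟨0, by rintro _ ⟨st, -, rfl⟩; exact comparisonAngle_nonneg _ _ _⟩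
  have hne : S.Nonempty := ⟨_, (1, 1), ⟨zero_lt_one, zero_lt_one⟩, rfl⟩
  refine ⟨sInf S, ?_⟩
  rw [tendsto_order]
  have hpos : ∀ᶠ st : I × I in 𝓝[>] (0 : I) ×ˢ 𝓝[>] (0 : I), 0 < st.1 ∧ 0 < st.2 :=
    (eventually_mem_nhdsWithin (a := (0 : I)) (s := Ioi 0)).prod_mk
      (eventually_mem_nhdsWithin (a := (0 : I)) (s := Ioi 0))
  constructor
  · intro a ha
    filter_upwards [hpos] with st hst
    exact ha.trans_le (csInf_le hbdd ⟨st, hst, rfl⟩)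
  · intro a ha
    obtain ⟨_, ⟨⟨s0, t0⟩, ⟨hs0, ht0⟩, rfl⟩, hlt⟩ := exists_lt_of_csInf_lt hne ha
    have h2 : ∀ᶠ st : I × I in 𝓝[>] (0 : I) ×ˢ 𝓝[>] (0 : I), st.1 ≤ s0 ∧ st.2 ≤ t0 :=
      (eventually_nhdsWithin_of_eventually_nhds (Iic_mem_nhds hs0)).prod_mk
        (eventually_nhdsWithin_of_eventually_nhds (Iic_mem_nhds ht0))
    filter_upwards [hpos, h2] with st h h'
    exact (comparisonAngle_mono c c' h.1 h.2 h'.1 h'.2).trans_lt hlt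

theorem alexandrovAngle_le (c c' : GeodesicFrom p) {s t : I} (hs : 0 < s) (ht : 0 < t) :
    alexandrovAngle c c' ≤ comparisonAngle p (c s) (c' t) := by
  refine le_of_tendsto (tendsto_comparisonAngle c c') ?_
  have h1 : ∀ᶠ st : I × I in 𝓝[>] (0 : I) ×ˢ 𝓝[>] (0 : I), 0 < st.1 ∧ 0 < st.2 :=
    (eventually_mem_nhdsWithin (a := (0 : I)) (s := Ioi 0)).prod_mk
      (eventually_mem_nhdsWithin (a := (0 : I)) (s := Ioi 0))
  have h2 : ∀ᶠ st : I × I in 𝓝[>] (0 : I) ×ˢ 𝓝[>] (0 : I), st.1 ≤ s ∧ st.2 ≤ t :=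
    (eventually_nhdsWithin_of_eventually_nhds (Iic_mem_nhds hs)).prod_mk
      (eventually_nhdsWithin_of_eventually_nhds (Iic_mem_nhds ht))
  filter_upwards [h1, h2] with st h h'
  exact comparisonAngle_mono c c' h.1 h.2 h'.1 h'.2

theorem alexandrovAngle_eq_of (c c' : GeodesicFrom p) {a : ℝ}
    (h : ∀ s t : I, 0 < s → 0 < t → comparisonAngle p (c s) (c' t) = a) :
    alexandrovAngle c c' = a := by
  refine tendsto_nhds_unique (tendsto_comparisonAngle c c') (tendsto_const_nhds.congr' ?_)
  have h1 : ∀ᶠ st : I × I in 𝓝[>] (0 : I) ×ˢ 𝓝[>] (0 : I), 0 < st.1 ∧ 0 < st.2 :=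
    (eventually_mem_nhdsWithin (a := (0 : I)) (s := Ioi 0)).prod_mk
      (eventually_mem_nhdsWithin (a := (0 : I)) (s := Ioi 0))
  filter_upwards [h1] with st h'
  exact (h _ _ h'.1 h'.2).symm

theorem alexandrovAngle_nonneg (c c' : GeodesicFrom p) : 0 ≤ alexandrovAngle c c' :=
  ge_of_tendsto' (tendsto_comparisonAngle c c') fun _ => comparisonAngle_nonneg _ _ _

theorem alexandrovAngle_le_pi (c c' : GeodesicFrom p) : alexandrovAngle c c' ≤ Real.pi :=
  le_of_tendsto' (tendsto_comparisonAngle c c') fun _ => comparisonAngle_le_pi _ _ _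

theorem alexandrovAngle_comm (c c' : GeodesicFrom p) :
    alexandrovAngle c c' = alexandrovAngle c' c := by
  refine tendsto_nhds_unique (tendsto_comparisonAngle c c') ?_
  have h := (tendsto_comparisonAngle c' c).comp (tendsto_snd.prodMk tendsto_fst)
  refine h.congr fun st => ?_
  exact comparisonAngle_comm _ _ _

theorem alexandrovAngle_self (c : GeodesicFrom p) : alexandrovAngle c c = 0 := by
  refine alexandrovAngle_eq_of c c fun s t hs ht => ?_
  by_cases hc : c.len = 0
  · simp [comparisonAngle, c.eq_source_iff hs, c.eq_source_iff ht, hc]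
  · have n1 : c s ≠ p := fun h => hc ((c.eq_source_iff hs).1 h)
    have n2 : c t ≠ p := fun h => hc ((c.eq_source_iff ht).1 h)
    have hs' : (s : ℝ) ≠ 0 := fun h => hs.ne' (Subtype.ext h)
    have ht' : (t : ℝ) ≠ 0 := fun h => ht.ne' (Subtype.ext h)
    rw [comparisonAngle_of_ne n1 n2, c.dist_source, c.dist_source, c.dist_eq, mul_pow _ |_|,
      sq_abs, ← Real.arccos_one]
    congr 1
    field_simp
    ring

theorem alexandrovAngle_of_zero_left (c c' : GeodesicFrom p) (h : c.len = 0) (h' : c'.len ≠ 0) :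
    alexandrovAngle c c' = Real.pi / 2 :=
  alexandrovAngle_eq_of c c' fun s t hs ht => by
    simp [comparisonAngle, c.eq_source_iff hs, c'.eq_source_iff ht, h, h']

theorem alexandrovAngle_of_zero_right (c c' : GeodesicFrom p) (h : c.len ≠ 0) (h' : c'.len = 0) :
    alexandrovAngle c c' = Real.pi / 2 := by
  rw [alexandrovAngle_comm, alexandrovAngle_of_zero_left c' c h' h]

theorem exists_bound_of_angle_lt (c c' : GeodesicFrom p) {a : ℝ} (h : alexandrovAngle c c' < a) :
    ∃ s0 : I, 0 < s0 ∧ ∀ s t : I, 0 < s → 0 < t → s ≤ s0 → t ≤ s0 →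
      comparisonAngle p (c s) (c' t) < a := by
  have h1 : ∀ᶠ st : I × I in 𝓝[>] (0 : I) ×ˢ 𝓝[>] (0 : I), 0 < st.1 ∧ 0 < st.2 :=
    (eventually_mem_nhdsWithin (a := (0 : I)) (s := Ioi 0)).prod_mk
      (eventually_mem_nhdsWithin (a := (0 : I)) (s := Ioi 0))
  obtain ⟨⟨s1, t1⟩, h2, h3⟩ :=
    (((tendsto_comparisonAngle c c').eventually_lt_const h).and h1).exists
  refine ⟨min s1 t1, lt_min h3.1 h3.2, fun s t hs ht hs' ht' => ?_⟩
  exact (comparisonAngle_mono c c' hs ht (hs'.trans (min_le_left _ _))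
    (ht'.trans (min_le_right _ _))).trans_lt h2

theorem triangle_identity {a b τ : ℝ}
    (h : τ * (Real.sin a + Real.sin b) = Real.sin (a + b)) :
    (1 + τ ^ 2 - 2 * τ * Real.cos a) * (Real.sin a + Real.sin b) ^ 2 =
      (2 - 2 * Real.cos (a + b)) * Real.sin a ^ 2 := by
  have : (1 + τ ^ 2 - 2 * τ * Real.cos a) * (Real.sin a + Real.sin b) ^ 2 =
      (Real.sin a + Real.sin b) ^ 2 + (τ * (Real.sin a + Real.sin b)) ^ 2
        - 2 * (τ * (Real.sin a + Real.sin b)) * (Real.sin a + Real.sin b) * Real.cos a := by ring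
  rw [this, h, Real.sin_add, Real.cos_add]
  have ia := Real.sin_sq_add_cos_sq a
  have ib := Real.sin_sq_add_cos_sq b
  generalize Real.sin a = x at *
  generalize Real.cos a = y at *
  generalize Real.sin b = z at *
  generalize Real.cos b = w at *
  linear_combination (-2 * x * z - z ^ 2) * ia + x ^ 2 * ib

theorem alexandrovAngle_triangle_aux (c₁ c₂ c₃ : GeodesicFrom p) (h₁ : 0 < c₁.len)
    (h₂ : 0 < c₂.len) (h₃ : 0 < c₃.len) :
    alexandrovAngle c₁ c₃ ≤ alexandrovAngle c₁ c₂ + alexandrovAngle c₂ c₃ := by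
  by_contra! hlt
  obtain ⟨a, b, ha, hb, hab⟩ : ∃ a b, alexandrovAngle c₁ c₂ < a ∧ alexandrovAngle c₂ c₃ < b ∧
      a + b < alexandrovAngle c₁ c₃ := by
    set δ := (alexandrovAngle c₁ c₃ - (alexandrovAngle c₁ c₂ + alexandrovAngle c₂ c₃)) / 3 with hδ
    exact ⟨alexandrovAngle c₁ c₂ + δ, alexandrovAngle c₂ c₃ + δ, by linarith, by linarith,
      by linarith⟩
  have ha0 : 0 < a := (alexandrovAngle_nonneg _ _).trans_lt ha
  have hb0 : 0 < b := (alexandrovAngle_nonneg _ _).trans_lt hb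
  have hpi := alexandrovAngle_le_pi c₁ c₃
  have hsa : 0 < Real.sin a := Real.sin_pos_of_pos_of_lt_pi ha0 (by linarith)
  have hsb : 0 < Real.sin b := Real.sin_pos_of_pos_of_lt_pi hb0 (by linarith)
  have hsab : 0 < Real.sin (a + b) := Real.sin_pos_of_pos_of_lt_pi (by linarith) (by linarith)
  set m := Real.sin a + Real.sin b with hm
  have hm0 : 0 < m := by positivity
  set τ := Real.sin (a + b) / m with hτ
  have hτ0 : 0 < τ := by positivity
  have hτm : τ * m = Real.sin (a + b) := by rw [hτ]; field_simp
  have hτ1 : τ ≤ 1 := by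
    rw [hτ, div_le_one hm0, Real.sin_add]
    nlinarith [Real.cos_le_one a, Real.cos_le_one b]
  obtain ⟨u, hu, hu'⟩ := exists_bound_of_angle_lt c₁ c₂ ha
  obtain ⟨v, hv, hv'⟩ := exists_bound_of_angle_lt c₂ c₃ hb
  set s0 := min u v
  have hs0 : (0 : ℝ) < s0 := lt_min hu hv
  obtain ⟨r, hr, hr1, hr2, hr3⟩ : ∃ r : ℝ, 0 < r ∧ r ≤ s0 * c₁.len ∧ r ≤ s0 * c₂.len ∧
      r ≤ s0 * c₃.len := by
    refine ⟨min (s0 * c₁.len) (min (s0 * c₂.len) (s0 * c₃.len)), ?_, min_le_left _ _, ?_, ?_⟩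
    · exact lt_min (by positivity) (lt_min (by positivity) (by positivity))
    · exact (min_le_right _ _).trans (min_le_left _ _)
    · exact (min_le_right _ _).trans (min_le_right _ _)
  obtain ⟨s₁, p₁, l₁, e₁⟩ := c₁.exists_point h₁ hr hr1
  obtain ⟨s₃, p₃, l₃, e₃⟩ := c₃.exists_point h₃ hr hr3
  obtain ⟨s₂, p₂, l₂, e₂⟩ := c₂.exists_point h₂ (r := τ * r) (by positivity)
    ((mul_le_of_le_one_left hr.le hτ1).trans hr2)
  have n₁ : c₁ s₁ ≠ p := fun h => h₁.ne' ((c₁.eq_source_iff p₁).1 h)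
  have n₂ : c₂ s₂ ≠ p := fun h => h₂.ne' ((c₂.eq_source_iff p₂).1 h)
  have n₃ : c₃ s₃ ≠ p := fun h => h₃.ne' ((c₃.eq_source_iff p₃).1 h)
  have f12 := hu' s₁ s₂ p₁ p₂ (l₁.trans (min_le_left _ _)) (l₂.trans (min_le_left _ _))
  have f23 := hv' s₂ s₃ p₂ p₃ (l₂.trans (min_le_right _ _)) (l₃.trans (min_le_right _ _))
  have f13 := hab.trans_le (alexandrovAngle_le c₁ c₃ p₁ p₃)
  have d12 := law_cos n₁ n₂
  have d23 := law_cos n₂ n₃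
  have d13 := law_cos n₁ n₃
  rw [e₁, e₂] at d12
  rw [e₂, e₃] at d23
  rw [e₁, e₃] at d13
  have g12 := Real.cos_le_cos_of_nonneg_of_le_pi (comparisonAngle_nonneg _ _ _)
    (by linarith : a ≤ Real.pi) f12.le
  have g23 := Real.cos_le_cos_of_nonneg_of_le_pi (comparisonAngle_nonneg _ _ _)
    (by linarith : b ≤ Real.pi) f23.le
  have g13 := Real.cos_lt_cos_of_nonneg_of_le_pi (by linarith : 0 ≤ a + b)
    (comparisonAngle_le_pi _ _ _) f13
  set D := Real.sqrt (2 - 2 * Real.cos (a + b)) with hD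
  have hD2 : D ^ 2 = 2 - 2 * Real.cos (a + b) :=
    Real.sq_sqrt (by linarith [Real.cos_le_one (a + b)])
  have hD0 : 0 ≤ D := Real.sqrt_nonneg _
  have idA := triangle_identity hτm
  have idB := triangle_identity (a := b) (b := a) (τ := τ) (by rw [add_comm, hτm, add_comm])
  rw [← hD2, ← hm] at idA
  rw [add_comm b a, ← hD2, add_comm (Real.sin b), ← hm] at idB
  have b12 : dist (c₁ s₁) (c₂ s₂) * m ≤ r * D * Real.sin a := by
    refine le_of_sq_le_sq ?_ (by positivity)
    have k : dist (c₁ s₁) (c₂ s₂) ^ 2 ≤ r ^ 2 * (1 + τ ^ 2 - 2 * τ * Real.cos a) := by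
      rw [d12]
      linarith [mul_le_mul_of_nonneg_left g12 (by positivity : 0 ≤ 2 * r * (τ * r))]
    calc _ = dist (c₁ s₁) (c₂ s₂) ^ 2 * m ^ 2 := by ring
      _ ≤ r ^ 2 * (1 + τ ^ 2 - 2 * τ * Real.cos a) * m ^ 2 := by gcongr
      _ = r ^ 2 * ((1 + τ ^ 2 - 2 * τ * Real.cos a) * m ^ 2) := by ring
      _ = _ := by rw [idA]; ring
  have b23 : dist (c₂ s₂) (c₃ s₃) * m ≤ r * D * Real.sin b := by
    refine le_of_sq_le_sq ?_ (by positivity)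
    have k : dist (c₂ s₂) (c₃ s₃) ^ 2 ≤ r ^ 2 * (1 + τ ^ 2 - 2 * τ * Real.cos b) := by
      rw [d23]
      linarith [mul_le_mul_of_nonneg_left g23 (by positivity : 0 ≤ 2 * r * (τ * r))]
    calc _ = dist (c₂ s₂) (c₃ s₃) ^ 2 * m ^ 2 := by ring
      _ ≤ r ^ 2 * (1 + τ ^ 2 - 2 * τ * Real.cos b) * m ^ 2 := by gcongr
      _ = r ^ 2 * ((1 + τ ^ 2 - 2 * τ * Real.cos b) * m ^ 2) := by ring
      _ = _ := by rw [idB]; ring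
  have tri := dist_triangle (c₁ s₁) (c₂ s₂) (c₃ s₃)
  have b13 : dist (c₁ s₁) (c₃ s₃) ≤ r * D := by
    refine le_of_mul_le_mul_right ?_ hm0
    calc _ ≤ (dist (c₁ s₁) (c₂ s₂) + dist (c₂ s₂) (c₃ s₃)) * m := by gcongr
      _ ≤ r * D * m := by rw [hm] at *; linarith
  have b13' := pow_le_pow_left₀ dist_nonneg b13 2
  rw [mul_pow, hD2, d13] at b13'
  linarith [mul_lt_mul_of_pos_left g13 (by positivity : 0 < 2 * r * r)]

theorem alexandrovAngle_triangle (c₁ c₂ c₃ : GeodesicFrom p) :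
    alexandrovAngle c₁ c₃ ≤ alexandrovAngle c₁ c₂ + alexandrovAngle c₂ c₃ := by
  have hpi := alexandrovAngle_le_pi c₁ c₃
  have n12 := alexandrovAngle_nonneg c₁ c₂
  have n23 := alexandrovAngle_nonneg c₂ c₃
  by_cases h₁ : c₁.len = 0 <;> by_cases h₂ : c₂.len = 0 <;> by_cases h₃ : c₃.len = 0
  · have : alexandrovAngle c₁ c₃ = 0 := alexandrovAngle_eq_of _ _ fun s t hs ht => by
      simp [comparisonAngle, c₁.eq_source_iff hs, c₃.eq_source_iff ht, h₁, h₃]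
    linarith
  · rw [alexandrovAngle_of_zero_left c₁ c₃ h₁ h₃, alexandrovAngle_of_zero_left c₂ c₃ h₂ h₃]
    linarith
  · have : alexandrovAngle c₁ c₃ = 0 := alexandrovAngle_eq_of _ _ fun s t hs ht => by
      simp [comparisonAngle, c₁.eq_source_iff hs, c₃.eq_source_iff ht, h₁, h₃]
    linarith
  · rw [alexandrovAngle_of_zero_left c₁ c₃ h₁ h₃, alexandrovAngle_of_zero_left c₁ c₂ h₁ h₂]
    linarith
  · rw [alexandrovAngle_of_zero_right c₁ c₃ h₁ h₃, alexandrovAngle_of_zero_right c₁ c₂ h₁ h₂]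
    linarith
  · rw [alexandrovAngle_of_zero_left c₂ c₃ h₂ h₃, alexandrovAngle_of_zero_right c₁ c₂ h₁ h₂]
    linarith
  · rw [alexandrovAngle_of_zero_right c₁ c₃ h₁ h₃, alexandrovAngle_of_zero_right c₂ c₃ h₂ h₃]
    linarith
  · exact alexandrovAngle_triangle_aux c₁ c₂ c₃ (lt_of_le_of_ne c₁.len_nonneg (Ne.symm h₁))
      (lt_of_le_of_ne c₂.len_nonneg (Ne.symm h₂)) (lt_of_le_of_ne c₃.len_nonneg (Ne.symm h₃))

end Angles

section Tangent

variable {X : Type*} [MetricSpace X] [CAT0Space X]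

/-- The normalized geodesics issuing from `p`, with the Alexandrov angle as pseudometric. -/
instance (p : X) : PseudoMetricSpace (GeodesicFrom p) where
  dist := alexandrovAngle
  dist_self := alexandrovAngle_self
  dist_comm := alexandrovAngle_comm
  dist_triangle := alexandrovAngle_triangle

/-- The space of directions at `p`: the metric space identified from the geodesics issuing
from `p`. Its distance `dist` is the angle. -/
abbrev Direction (p : X) := SeparationQuotient (GeodesicFrom p)

/-- The zero geodesic indicator: `0` if `c` is a zero geodesic and `1` otherwise. -/
def GeodesicFrom.zeta {p : X} (c : GeodesicFrom p) : ℝ≥0 :=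
  open Classical in if c 1 = p then 0 else 1

theorem zeta_congr {p : X} (c c' : GeodesicFrom p) (h : Inseparable c c') : c.zeta = c'.zeta := by
  have h0 : alexandrovAngle c c' = 0 := Metric.inseparable_iff.1 h
  have hpi := Real.pi_pos
  have e := c.eq_source_iff (zero_lt_one (α := I))
  have e' := c'.eq_source_iff (zero_lt_one (α := I))
  unfold GeodesicFrom.zeta
  by_cases h1 : c.len = 0 <;> by_cases h2 : c'.len = 0
  · simp [e, e', h1, h2]
  · rw [alexandrovAngle_of_zero_left c c' h1 h2] at h0; linarith
  · rw [alexandrovAngle_of_zero_right c c' h1 h2] at h0; linarith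
  · simp [e, e', h1, h2]

/-- The zero geodesic indicator on the space of directions. -/
def zeta {p : X} : Direction p → ℝ≥0 := SeparationQuotient.lift GeodesicFrom.zeta zeta_congr

/-- The equivalence relation on `[0,∞) × S_p` whose quotient is the tangent space at `p`. -/
def tangentSetoid (p : X) : Setoid (ℝ≥0 × Direction p) where
  r v w := (v.1 * zeta v.2 = 0 ∧ w.1 * zeta w.2 = 0) ∨
    (v.1 * zeta v.2 = w.1 * zeta w.2 ∧ 0 < w.1 * zeta w.2 ∧ v.2 = w.2)
  iseqv := by
    refine ⟨fun v => ?_, ?_, ?_⟩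
    · rcases eq_or_ne (v.1 * zeta v.2) 0 with h | h
      · exact Or.inl ⟨h, h⟩
      · exact Or.inr ⟨rfl, pos_iff_ne_zero.2 h, rfl⟩
    · rintro v w (⟨h, h'⟩ | ⟨h, h', h''⟩)
      · exact Or.inl ⟨h', h⟩
      · exact Or.inr ⟨h.symm, h ▸ h', h''.symm⟩
    · rintro u v w (⟨h, h'⟩ | ⟨h, h', h''⟩) (⟨k, k'⟩ | ⟨k, k', k''⟩)
      · exact Or.inl ⟨h, k'⟩
      · exact absurd (k ▸ h') k'.ne'
      · exact absurd k h'.ne'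
      · exact Or.inr ⟨h.trans k, k', h''.trans k''⟩

/-- The tangent space (tangent cone) `T_p X`. -/
def TangentCone (p : X) := Quotient (tangentSetoid p)

namespace TangentCone

variable {p : X}

/-- The tangent vector `t γ`, for `t ≥ 0` and a direction `γ` at `p`. -/
def mk (t : ℝ≥0) (γ : Direction p) : TangentCone p := Quotient.mk (tangentSetoid p) (t, γ)

/-- The formula for the tangent distance on representatives. -/
def preDist (v w : ℝ≥0 × Direction p) : ℝ :=
  Real.sqrt ((v.1 : ℝ) ^ 2 * zeta v.2 + (w.1 : ℝ) ^ 2 * zeta w.2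
    - 2 * v.1 * w.1 * zeta v.2 * zeta w.2 * Real.cos (dist v.2 w.2))

theorem zeta_zero_or_one (γ : Direction p) : zeta γ = 0 ∨ zeta γ = 1 := by
  obtain ⟨c, rfl⟩ := SeparationQuotient.surjective_mk γ
  change c.zeta = 0 ∨ c.zeta = 1
  unfold GeodesicFrom.zeta
  split_ifs <;> simp

theorem preDist_comm (v w : ℝ≥0 × Direction p) : preDist v w = preDist w v := by
  unfold preDist
  rw [dist_comm]
  congr 1
  ring

theorem preDist_congr_left {v v' : ℝ≥0 × Direction p} (w : ℝ≥0 × Direction p)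
    (h : tangentSetoid p v v') : preDist v w = preDist v' w := by
  have key : ∀ u : ℝ≥0 × Direction p, u.1 * zeta u.2 = 0 → (u.1 = 0 ∨ zeta u.2 = 0) :=
    fun u hu => mul_eq_zero.1 hu
  rcases h with ⟨h, h'⟩ | ⟨h, h', h''⟩
  · have : ∀ u : ℝ≥0 × Direction p, u.1 * zeta u.2 = 0 →
        preDist u w = Real.sqrt ((w.1 : ℝ) ^ 2 * zeta w.2) := by
      intro u hu
      rcases key u hu with hu | hu <;> simp [preDist, hu]
    rw [this v h, this v' h']
  · have hz : zeta v'.2 ≠ 0 := fun h0 => by simp [h0] at h'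
    rw [h''] at h
    have : v = v' := Prod.ext (mul_right_cancel₀ hz h) h''
    rw [this]

/-- The metric `d_p` of the tangent space. -/
def tdist (v w : TangentCone p) : ℝ :=
  Quotient.liftOn₂ v w preDist fun _ b a' _ h h' =>
    (preDist_congr_left b h).trans
      ((preDist_comm _ _).trans ((preDist_congr_left a' h').trans (preDist_comm _ _)))

end TangentCone

/-- The normalized geodesic `γ_{p,q}` joining `p` and `q` (it is unique in a `CAT(0)` space). -/
def geodesic (p q : X) : GeodesicFrom p where
  toNormalizedGeodesic := (CAT0Space.exists_geodesic p q).choose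
  source' := (CAT0Space.exists_geodesic p q).choose_spec.1

/-- The direction at `p` of the geodesic `γ_{p,q}`. -/
def direction (p q : X) : Direction p := SeparationQuotient.mk (geodesic p q)

namespace TangentCone

/-- The zero vector `0_p`. -/
def zero (p : X) : TangentCone p := mk 0 (direction p p)

variable {p : X}

/-- The norm `‖v‖_p = d_p(0_p, v)`. -/
def tnorm (v : TangentCone p) : ℝ := tdist (zero p) v

/-- The product `g_p` on the tangent space. -/
def g (v w : TangentCone p) : ℝ := (tnorm v ^ 2 + tnorm w ^ 2 - tdist v w ^ 2) / 2

/-- The tangent vector `t γ_{p,q}` at `p`. -/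
def toward (t : ℝ≥0) (p q : X) : TangentCone p := mk t (direction p q)

end TangentCone

end Tangent

section VectorFields

variable {X : Type*} [MetricSpace X] [CAT0Space X]

open TangentCone

variable (X) in
/-- A set-valued vector field `A : X ⊸ TX`, `A p ⊆ T_p X`. -/
def VectorField := (p : X) → Set (TangentCone p)

namespace VectorField

/-- Monotonicity of a set-valued vector field. -/
def IsMonotone (A : VectorField X) : Prop :=
  ∀ (p q : X), ∀ η ∈ A p, ∀ ν ∈ A q, g η (toward 1 p q) ≤ -g ν (toward 1 q p)

/-- The surjectivity condition. -/
def SurjectivityCondition (A : VectorField X) : Prop :=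
  ∀ (t : ℝ≥0), 0 < t → ∀ x : X, ∃ p : X, toward (t * nndist p x) p x ∈ A p

/-- The zero set `A⁻¹(𝟎)`: the points `p` such that `A p` meets the zero section. -/
def zeros (A : VectorField X) : Set X := {p | zero p ∈ A p}

/-- The (set-valued) resolvent `J_l`, with `J_0` the identity. -/
def resolvent (A : VectorField X) (l : ℝ≥0) (x : X) : Set X :=
  {z | if l = 0 then z = x else toward (l⁻¹ * nndist z x) z x ∈ A z}

end VectorField

end VectorFields

/-- The (set-valued) metric projection `P_C x = argmin_{y ∈ C} dist x y`. -/
def proj {X : Type*} [MetricSpace X] (C : Set X) (x : X) : Set X :=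
  {y | y ∈ C ∧ ∀ z ∈ C, dist x y ≤ dist x z}

end CAT0

end

/-! The tangent geometry enters through one estimate. In a CAT(0) space the Alexandrov angle is at
most the comparison angle, so replacing it in the law of cosines bounds
$t(\rho(p,x)^2+\rho(p,q)^2-\rho(x,q)^2)$ by $2\rho(p,q)\,g_p(t\rho(p,x)\gamma_{p,x},\gamma_{p,q})$
(`le_dist_mul_g_toward`). Adding this at $p$ and at $q$ and using monotonicity leaves a purely
metric inequality, `IsMonotone.toward_add_toward_le`; everything else is an instance of it.

Two resolvents with the same $\lambda$ and $x$ must coincide; existence is the surjectivity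
condition. Comparing $z=J_\lambda x$ with a zero $y$ gives the Pythagorean inequality
$\rho(z,x)^2+\rho(z,y)^2\le\rho(x,y)^2$. Comparing $J_\lambda x$ with $J_\mu x$ for $0<\lambda<\mu$
gives $\rho(J_\lambda x,J_\mu x)^2\le\rho(J_\mu x,x)^2-\rho(J_\lambda x,x)^2$. So $\rho(J_\lambda
x,x)^2$ is monotone and bounded, which makes the resolvent curve Cauchy.

Comparing its limit $z$ with $w=J_1z$ shows $w=z$, so $z$ is a zero. The Pythagorean inequality
passes to the limit and says that $z$ is the unique zero nearest to $x$. -/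

namespace CAT0

/-! ### The product $g_p$ and the law of cosines inequality. -/

section LawOfCosines

variable {X : Type*} [MetricSpace X] [CAT0Space X]

theorem geodesic_one (p q : X) : geodesic p q 1 = q :=
  (CAT0Space.exists_geodesic p q).choose_spec.2

theorem zeta_direction_of_ne {p q : X} (h : q ≠ p) : zeta (direction p q) = 1 := by
  change (geodesic p q).zeta = 1
  simp [GeodesicFrom.zeta, geodesic_one, h]

theorem dist_direction (p q r : X) :
    dist (direction p q) (direction p r) = alexandrovAngle (geodesic p q) (geodesic p r) := rfl

namespace TangentCone

theorem tdist_mk_sq {p : X} (t s : ℝ≥0) (γ γ' : Direction p) :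
    tdist (mk t γ) (mk s γ') ^ 2 = (t : ℝ) ^ 2 * zeta γ + (s : ℝ) ^ 2 * zeta γ'
      - 2 * t * s * zeta γ * zeta γ' * Real.cos (dist γ γ') := by
  refine Real.sq_sqrt ?_
  have hc := Real.cos_le_one (dist γ γ')
  have ht := t.coe_nonneg
  have hs := s.coe_nonneg
  rcases zeta_zero_or_one γ with h | h <;> rcases zeta_zero_or_one γ' with h' | h' <;>
    simp only [h, h', NNReal.coe_zero, NNReal.coe_one]
  · simp
  · simp
  · simp
  -- With both directions nonzero the radicand is $(t-s)^2+2ts(1-\cos\angle)$, so the square root is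
  -- not truncated.
  · nlinarith [sq_nonneg ((t : ℝ) - s), mul_nonneg (mul_nonneg ht hs) (sub_nonneg.2 hc)]

theorem tnorm_mk_sq {p : X} (t : ℝ≥0) (γ : Direction p) :
    tnorm (mk t γ) ^ 2 = (t : ℝ) ^ 2 * zeta γ := by
  rw [tnorm, zero, tdist_mk_sq]
  simp

/-- Polarization: the norm terms cancel and only the cosine term survives. -/
theorem g_mk {p : X} (t s : ℝ≥0) (γ γ' : Direction p) :
    g (mk t γ) (mk s γ') = t * s * zeta γ * zeta γ' * Real.cos (dist γ γ') := by
  rw [g, tnorm_mk_sq, tnorm_mk_sq, tdist_mk_sq]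
  ring

/-- The law of cosines inequality in a `CAT(0)` space, in terms of the product `g_p`. -/
theorem le_dist_mul_g_toward (t : ℝ≥0) (p x q : X) :
    t * (dist p x ^ 2 + dist p q ^ 2 - dist x q ^ 2) ≤
      2 * (dist p q * g (toward (t * nndist p x) p x) (toward 1 p q)) := by
  rw [toward, toward, g_mk]
  -- `law_cos` needs both points distinct from $p$. In the degenerate cases both sides vanish, so
  -- the angle conventions play no role.
  rcases eq_or_ne x p with rfl | hx
  · simp
  rcases eq_or_ne q p with rfl | hq
  · simp [dist_comm]
  -- Comparison angles decrease towards the Alexandrov angle, so parameter 1, that is the endpoints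
  -- themselves, already gives an upper bound.
  have hle := alexandrovAngle_le (geodesic p x) (geodesic p q) zero_lt_one zero_lt_one
  rw [geodesic_one, geodesic_one] at hle
  have hcos := Real.cos_le_cos_of_nonneg_of_le_pi (alexandrovAngle_nonneg _ _)
    (comparisonAngle_le_pi _ _ _) hle
  have hpos : 0 ≤ 2 * (t : ℝ) * dist p x * dist p q := by positivity
  have := mul_le_mul_of_nonneg_left hcos hpos
  rw [law_cos hx hq, zeta_direction_of_ne hx, zeta_direction_of_ne hq, dist_direction]
  push_cast
  linarith

end TangentCone

end LawOfCosines

/-! ### Metric consequences of monotonicity for resolvents and zeros. -/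

namespace VectorField

variable {X : Type*} [MetricSpace X] [CAT0Space X] {A : VectorField X}

open TangentCone

/-- The vector $\gamma_{p,q}$ has norm 1 when $p\ne q$, so monotonicity is multiplied by $\rho(p,q)$
before the two law of cosines bounds are inserted; this also covers $p=q$. -/
theorem IsMonotone.toward_add_toward_le (hA : A.IsMonotone) {s t : ℝ≥0} {p q x y : X}
    (hp : toward (s * nndist p x) p x ∈ A p) (hq : toward (t * nndist q y) q y ∈ A q) :
    s * (dist p x ^ 2 + dist p q ^ 2 - dist x q ^ 2)
      + t * (dist q y ^ 2 + dist p q ^ 2 - dist y p ^ 2) ≤ 0 := by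
  have h := mul_le_mul_of_nonneg_left (hA p q _ hp _ hq) (dist_nonneg (x := p) (y := q))
  have h1 := le_dist_mul_g_toward s p x q
  have h2 := le_dist_mul_g_toward t q y p
  rw [dist_comm q p] at h2
  linarith

/-- The scalar is 0 whatever $t$ is. This puts a zero $p$ into the form required by
`IsMonotone.toward_add_toward_le`, with $p$ as its own target. -/
theorem toward_self_mem {p : X} (hp : p ∈ A.zeros) (t : ℝ≥0) :
    toward (t * nndist p p) p p ∈ A p := by
  simpa [zeros, zero, toward] using hp

theorem mem_zeros_of_toward_self_mem {p : X} {t : ℝ≥0}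
    (hp : toward (t * nndist p p) p p ∈ A p) : p ∈ A.zeros := by
  simpa [zeros, zero, toward] using hp

theorem mem_resolvent {l : ℝ≥0} (hl : l ≠ 0) {x z : X} :
    z ∈ A.resolvent l x ↔ toward (l⁻¹ * nndist z x) z x ∈ A z := by
  simp [resolvent, hl]

theorem IsMonotone.subsingleton_resolvent (hA : A.IsMonotone) (l : ℝ≥0) (x : X) :
    (A.resolvent l x).Subsingleton := by
  intro p hp q hq
  rcases eq_or_ne l 0 with rfl | hl
  · simp only [resolvent, if_true, mem_ofPred_eq] at hp hq
    rw [hp, hq]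
  have h := hA.toward_add_toward_le ((mem_resolvent hl).1 hp) ((mem_resolvent hl).1 hq)
  rw [dist_comm x q, dist_comm x p] at h
  have hl' : (0 : ℝ) < (l⁻¹ : ℝ≥0) := by
    exact_mod_cast inv_pos.2 (pos_iff_ne_zero.2 hl)
  -- With equal weights and targets the mixed terms cancel, and `h` reads
  -- $2\lambda^{-1}\rho(p,q)^2\le0$.
  have h0 : dist p q ^ 2 ≤ 0 := by
    by_contra! hlt
    have := mul_pos hl' hlt
    linarith
  exact dist_eq_zero.1 (pow_eq_zero_iff two_ne_zero |>.1 (le_antisymm h0 (sq_nonneg _)))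

theorem SurjectivityCondition.nonempty_resolvent (hA : A.SurjectivityCondition)
    (l : ℝ≥0) (x : X) : (A.resolvent l x).Nonempty := by
  rcases eq_or_ne l 0 with rfl | hl
  · exact ⟨x, by simp [resolvent]⟩
  · obtain ⟨p, hp⟩ := hA l⁻¹ (inv_pos.2 (pos_iff_ne_zero.2 hl)) x
    exact ⟨p, (mem_resolvent hl).2 hp⟩

/-- The summand belonging to the zero $y$ vanishes identically, and the positive factor
$\lambda^{-1}$ can be divided out. -/
theorem IsMonotone.dist_sq_add_dist_sq_le (hA : A.IsMonotone) {l : ℝ≥0} (hl : l ≠ 0)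
    {x z y : X} (hz : z ∈ A.resolvent l x) (hy : y ∈ A.zeros) :
    dist z x ^ 2 + dist z y ^ 2 ≤ dist x y ^ 2 := by
  have h := hA.toward_add_toward_le ((mem_resolvent hl).1 hz) (toward_self_mem hy 1)
  rw [dist_comm y z] at h
  have hl' : (0 : ℝ) < (l⁻¹ : ℝ≥0) := by
    exact_mod_cast inv_pos.2 (pos_iff_ne_zero.2 hl)
  simp only [dist_self] at h
  by_contra! hlt
  have := mul_pos hl' (sub_pos.2 hlt)
  linarith

theorem IsMonotone.dist_sq_le_sub_of_lt (hA : A.IsMonotone) {l m : ℝ≥0} (hl : l ≠ 0)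
    (hlm : l < m) {x z w : X} (hz : z ∈ A.resolvent l x) (hw : w ∈ A.resolvent m x) :
    dist z w ^ 2 ≤ dist w x ^ 2 - dist z x ^ 2 := by
  have hm : m ≠ 0 := (bot_lt_of_lt hlm).ne'
  have h := hA.toward_add_toward_le ((mem_resolvent hl).1 hz) ((mem_resolvent hm).1 hw)
  rw [dist_comm x w, dist_comm x z] at h
  have hinv : ((m⁻¹ : ℝ≥0) : ℝ) < (l⁻¹ : ℝ≥0) := by
    exact_mod_cast inv_strictAnti₀ (pos_iff_ne_zero.2 hl) hlm
  have hm0 := (m⁻¹ : ℝ≥0).coe_nonneg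
  generalize ((m⁻¹ : ℝ≥0) : ℝ) = b at *
  generalize ((l⁻¹ : ℝ≥0) : ℝ) = a at *
  by_contra! hlt
  -- With $a=\lambda^{-1}>b=\mu^{-1}$, where $\mu$ is `m`, and $D=\rho(z,w)^2$, `h` reads
  -- $(a+b)D\le(a-b)(\rho(w,x)^2-\rho(z,x)^2)$. Splitting $a+b=(a-b)+2b$ gives the contradiction.
  have h1 := mul_pos (sub_pos.2 hinv) (sub_pos.2 hlt)
  have h2 := mul_nonneg hm0 (sq_nonneg (dist z w))
  linarith

/-! ### Convergence of the resolvents and identification of the limit. -/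

section Limit

variable {J : ℝ≥0 → X} {x : X}

theorem IsMonotone.cauchy_map_resolvent (hA : A.IsMonotone) (hne : A.zeros.Nonempty)
    (hJ : ∀ l, J l ∈ A.resolvent l x) : Cauchy (map J atTop) := by
  obtain ⟨y, hy⟩ := hne
  -- The estimates require a nonzero parameter; truncating at 1 makes `a` monotone on all of `ℝ≥0`
  -- without changing its behaviour at infinity.
  set a : ℝ≥0 → ℝ := fun l => dist (J (max l 1)) x ^ 2
  have hne0 : ∀ l : ℝ≥0, max l 1 ≠ 0 := fun l => (zero_lt_one.trans_le (le_max_right l 1)).ne'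
  have hmono : Monotone a := by
    intro l m hlm
    rcases (max_le_max_right 1 hlm).eq_or_lt with h | h
    · simp only [a, h, le_refl]
    · have := hA.dist_sq_le_sub_of_lt (hne0 l) h (hJ _) (hJ _)
      have h0 := sq_nonneg (dist (J (max l 1)) (J (max m 1)))
      change dist (J (max l 1)) x ^ 2 ≤ dist (J (max m 1)) x ^ 2
      linarith
  have hbdd : BddAbove (range a) := by
    refine ⟨dist x y ^ 2, ?_⟩
    rintro _ ⟨l, rfl⟩
    have := hA.dist_sq_add_dist_sq_le (hne0 l) (hJ _) hy
    have h0 := sq_nonneg (dist (J (max l 1)) y)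
    change dist (J (max l 1)) x ^ 2 ≤ _
    linarith
  have hlim := tendsto_atTop_ciSup hmono hbdd
  set S := ⨆ l, a l
  refine Metric.cauchy_iff.2 ⟨inferInstance, fun ε hε => ?_⟩
  -- For $l<m$ beyond the threshold, the squared distance is at most $a(m)-a(l)\le
  -- S-a(l)<\varepsilon^2$.
  have hev : ∀ᶠ l in atTop, S - ε ^ 2 < a l :=
    hlim.eventually_const_lt (by have := pow_pos hε 2; linarith)
  obtain ⟨L, hL⟩ := eventually_atTop.1 hev
  refine ⟨J '' Ici (max L 1), image_mem_map (Ici_mem_atTop _), ?_⟩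
  have key : ∀ l m : ℝ≥0, max L 1 ≤ l → l < m → dist (J l) (J m) < ε := by
    intro l m hl hlm
    have h1 : max l 1 = l := max_eq_left ((le_max_right _ _).trans hl)
    have h2 : max m 1 = m := max_eq_left (((le_max_right _ _).trans hl).trans hlm.le)
    have h3 := hL l ((le_max_left _ _).trans hl)
    have h4 := le_ciSup hbdd m
    have h5 := hA.dist_sq_le_sub_of_lt (h1 ▸ hne0 l) hlm (hJ l) (hJ m)
    simp only [a, h1] at h3
    change a m ≤ S at h4
    simp only [a, h2] at h4
    exact lt_of_pow_lt_pow_left₀ 2 hε.le (by linarith)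
  rintro _ ⟨l, hl, rfl⟩ _ ⟨m, hm, rfl⟩
  rcases lt_trichotomy l m with h | rfl | h
  · exact key l m hl h
  · simpa using hε
  · rw [dist_comm]
    exact key m l hm h

/-- Surjectivity replaces a closedness assumption on $A$: it supplies a resolvent $w$ of the limit
$z$, and comparison with `J l` forces $w=z$. -/
theorem IsMonotone.mem_zeros_of_tendsto_resolvent (hA : A.IsMonotone)
    (hsurj : A.SurjectivityCondition) (hJ : ∀ l, J l ∈ A.resolvent l x) {z : X}
    (hz : Tendsto J atTop (𝓝 z)) : z ∈ A.zeros := by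
  obtain ⟨w, hw⟩ := hsurj 1 zero_lt_one z
  have hinv : Tendsto (fun l : ℝ≥0 => ((l⁻¹ : ℝ≥0) : ℝ)) atTop (𝓝 0) := by
    simpa using NNReal.tendsto_coe.2 (tendsto_inv_atTop_zero (𝕜 := ℝ≥0))
  -- The part weighted by $l^{-1}$ tends to 0 because its other factor converges; the remaining part
  -- tends to $2\rho(w,z)^2$.
  have hlim := (hinv.mul ((((hz.dist (tendsto_const_nhds (x := x))).pow 2).add
    ((hz.dist (tendsto_const_nhds (x := w))).pow 2)).sub
      (tendsto_const_nhds (x := dist x w ^ 2)))).add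
    (((tendsto_const_nhds (x := dist w z ^ 2)).add
      ((hz.dist (tendsto_const_nhds (x := w))).pow 2)).sub
      (((tendsto_const_nhds (x := z)).dist hz).pow 2))
  have hle := le_of_tendsto (b := 0) hlim <| by
    filter_upwards [eventually_ne_atTop 0] with l hl
    have h := hA.toward_add_toward_le ((mem_resolvent hl).1 (hJ l)) hw
    rw [NNReal.coe_one, one_mul] at h
    exact h
  have h0 : dist w z = 0 := by
    rw [dist_comm z w, dist_self] at hle
    nlinarith [sq_nonneg (dist w z)]
  obtain rfl := dist_eq_zero.1 h0
  exact mem_zeros_of_toward_self_mem hw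

theorem IsMonotone.proj_eq_singleton_of_tendsto_resolvent (hA : A.IsMonotone)
    (hsurj : A.SurjectivityCondition) (hJ : ∀ l, J l ∈ A.resolvent l x) {z : X}
    (hz : Tendsto J atTop (𝓝 z)) : proj A.zeros x = {z} := by
  have hzero := hA.mem_zeros_of_tendsto_resolvent hsurj hJ hz
  have key : ∀ y ∈ A.zeros, dist x z ^ 2 + dist z y ^ 2 ≤ dist x y ^ 2 := by
    intro y hy
    rw [dist_comm x z]
    refine le_of_tendsto (((hz.dist tendsto_const_nhds).pow 2).add
      ((hz.dist tendsto_const_nhds).pow 2)) ?_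
    filter_upwards [eventually_ne_atTop 0] with l hl
    exact hA.dist_sq_add_dist_sq_le hl (hJ l) hy
  refine eq_singleton_iff_unique_mem.2 ⟨⟨hzero, fun y hy => ?_⟩, fun y hy => ?_⟩
  · have h := key y hy
    exact le_of_sq_le_sq (by linarith [sq_nonneg (dist z y)]) dist_nonneg
  · have h1 := key y hy.1
    have h2 := pow_le_pow_left₀ dist_nonneg (hy.2 z hzero) 2
    have h3 : dist z y ^ 2 = 0 := le_antisymm (by linarith) (sq_nonneg _)
    exact (dist_eq_zero.1 (pow_eq_zero_iff two_ne_zero |>.1 h3)).symm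

end Limit

end VectorField

end CAT0

theorem theorem4p11 {H : Type*} [MetricSpace H] [CompleteSpace H] [CAT0.CAT0Space H]
    (hH : CAT0.GeodesicExtensionProperty H)
    (A : CAT0.VectorField H) (hA : A.IsMonotone) (hsurj : A.SurjectivityCondition)
    (hzeros : A.zeros.Nonempty) :
    ∃ (J : ℝ≥0 → H → H) (P : H → H),
      (∀ l x, A.resolvent l x = {J l x}) ∧
      (∀ x, CAT0.proj A.zeros x = {P x}) ∧
      ∀ x, Tendsto (fun l => J l x) atTop (𝓝 (P x)) := by
  choose J hJ using fun l x => hsurj.nonempty_resolvent l x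
  -- `P x` is first only the limit of the resolvents; it is recognized as the projection afterwards.
  choose P hP using fun x =>
    CompleteSpace.complete (hA.cauchy_map_resolvent hzeros fun l => hJ l x)
  exact ⟨J, P, fun l x => (hA.subsingleton_resolvent l x).eq_singleton_of_mem (hJ l x),
    fun x => hA.proj_eq_singleton_of_tendsto_resolvent hsurj (fun l => hJ l x) (hP x), hP⟩
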